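/- Let $\ell\ge 0$ be an integer and let $\mathbb{H}=\{z\in\mathbb{C}:\operatorname{Re} z>0\}$. Let $A^2_\ell$ be the weighted Bergman space of all analytic functions $h:\mathbb{H}\to\mathbb{C}$ with $$\|h\|^2=\frac1\pi\int_{-\infty}^{\infty}\int_0^{\infty}x^\ell\,|h(x+iy)|^2\,dx\,dy<\infty ,$$ equipped with the corresponding inner product. Let $f:\mathbb{H}\to\mathbb{C}$ and $g:\mathbb{H}\to\mathbb{H}$ be analytic, and let $W_{f,g,\max}$ be the maximal weighted composition operator on $A^2_\ell$, that is, the operator with domain $\{h\in A^2_\ell: f\cdot(h\circ g)\in A^2_\ell\}$ given there by $W_{f,g,\max}h=f\cdot(h\circ g)$. Then $W_{f,g,\max}$ is unitary on $A^2_\ell$ (that is, its domain is all of $A^2_\ell$, it preserves the inner product, and it maps onto $A^2_\ell$) if and only if one of the following holds: 1. there are $C\in\mathbb{C}\setminus\{0\}$ and $\delta\in\mathbb{R}$ such that, for all $z\in\mathbb{H}$, $$g(z)=|C|^{2/(\ell+2)}z+i\delta,\qquad f(z)=C;$$ 2. there are $\beta\in\mathbb{C}\setminus\{0\}$ and $\alpha,\theta\in\mathbb{R}$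 such that, for all $z\in\mathbb{H}$, $$g(z)=\frac{|\beta|^{2/(\ell+2)}}{z-i\alpha}+i\theta,\qquad f(z)=\frac{\beta}{(z-i\alpha)^{\ell+2}}.$$ -/

import Mathlib

open MeasureTheory

noncomputable section

/-- The open right half-plane `{z ∈ ℂ : Re z > 0}`, as a type. -/
abbrev RightHalfPlane : Type := {z : ℂ // 0 < z.re}

/-- A function on the right half-plane is analytic if it is (the restriction of a function that is)
complex differentiable at every point of the half-plane. -/
def IsAnalyticRHP (h : RightHalfPlane → ℂ) : Prop :=
  ∃ F : ℂ → ℂ, DifferentiableOn ℂ F {z : ℂ | 0 < z.re} ∧ ∀ z : RightHalfPlane, F z = h z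

/-- The measure `π⁻¹ x ^ ℓ dx dy` on the right half-plane (`z = x + i y`). -/
def bergmanMeasure (ℓ : ℕ) : Measure RightHalfPlane :=
  (Measure.comap (Subtype.val : RightHalfPlane → ℂ) volume).withDensity
    (fun z => ENNReal.ofReal (Real.pi⁻¹ * (z : ℂ).re ^ ℓ))

theorem IsAnalyticRHP.continuous {h : RightHalfPlane → ℂ} (hh : IsAnalyticRHP h) :
    Continuous h := by
  obtain ⟨F, hF, hFh⟩ := hh
  have : h = fun z : RightHalfPlane => F z := funext fun z => (hFh z).symm
  rw [this]
  exact hF.continuousOn.comp_continuous continuous_subtype_val (fun z => z.2)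

theorem measurableSet_rhp : MeasurableSet {z : ℂ | 0 < z.re} :=
  (isOpen_lt continuous_const Complex.continuous_re).measurableSet

instance bergmanMeasure_isOpenPosMeasure (ℓ : ℕ) : (bergmanMeasure ℓ).IsOpenPosMeasure := by
  have hpos : (Measure.comap (Subtype.val : RightHalfPlane → ℂ) volume).IsOpenPosMeasure := by
    refine ⟨fun U hU hne h0 => ?_⟩
    have he : MeasurableEmbedding (Subtype.val : RightHalfPlane → ℂ) :=
      MeasurableEmbedding.subtype_coe measurableSet_rhp
    rw [he.comap_apply] at h0
    have ho : IsOpen ((Subtype.val : RightHalfPlane → ℂ) '' U) :=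
      (isOpen_lt continuous_const Complex.continuous_re).isOpenMap_subtype_val U hU
    exact (ho.measure_pos volume (hne.image _)).ne' h0
  refine Measure.AbsolutelyContinuous.isOpenPosMeasure
    (μ := Measure.comap (Subtype.val : RightHalfPlane → ℂ) volume) ?_
  refine withDensity_absolutelyContinuous' ?_ ?_
  · fun_prop
  · refine Filter.Eventually.of_forall fun z => ?_
    have := z.2
    simp only [ne_eq, ENNReal.ofReal_eq_zero, not_le]
    positivity

/-- The analytic functions on the right half-plane with
`π⁻¹ ∫∫ x ^ ℓ |h (x + i y)| ^ 2 dx dy < ∞`, as a linear subspace of all functions. -/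
def bergmanSubmodule (ℓ : ℕ) : Submodule ℂ (RightHalfPlane → ℂ) where
  carrier := {h | IsAnalyticRHP h ∧ MemLp h 2 (bergmanMeasure ℓ)}
  zero_mem' := ⟨⟨0, differentiableOn_const 0, fun _ => rfl⟩, MemLp.zero⟩
  add_mem' := by
    rintro a b ⟨⟨A, hA, hAa⟩, ha⟩ ⟨⟨B, hB, hBb⟩, hb⟩
    exact ⟨⟨A + B, hA.add hB, fun z => by simp [hAa, hBb]⟩, ha.add hb⟩
  smul_mem' := by
    rintro c a ⟨⟨A, hA, hAa⟩, ha⟩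
    exact ⟨⟨c • A, hA.const_smul c, fun z => by simp [hAa]⟩, ha.const_smul c⟩

/-- The weighted Bergman space `A²_ℓ` of the right half-plane. It is a type of its own (and not the
coercion of the submodule), so that it carries the Bergman norm and not the topology of pointwise
convergence. -/
def BergmanSpace (ℓ : ℕ) : Type := bergmanSubmodule ℓ

namespace BergmanSpace

variable {ℓ : ℕ}

instance : AddCommGroup (BergmanSpace ℓ) := inferInstanceAs (AddCommGroup (bergmanSubmodule ℓ))

instance : Module ℂ (BergmanSpace ℓ) := inferInstanceAs (Module ℂ (bergmanSubmodule ℓ))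

instance : CoeFun (BergmanSpace ℓ) (fun _ => RightHalfPlane → ℂ) := ⟨fun h => h.1⟩

theorem ext {h k : BergmanSpace ℓ} (H : ∀ z, h z = k z) : h = k := Subtype.ext (funext H)

theorem analytic (h : BergmanSpace ℓ) : IsAnalyticRHP h := h.2.1

theorem memLp (h : BergmanSpace ℓ) : MemLp h 2 (bergmanMeasure ℓ) := h.2.2

@[simp] theorem add_apply (h k : BergmanSpace ℓ) (z : RightHalfPlane) : (h + k) z = h z + k z := rfl

@[simp] theorem smul_apply (c : ℂ) (h : BergmanSpace ℓ) (z : RightHalfPlane) :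
    (c • h) z = c * h z := rfl

@[simp] theorem zero_apply (z : RightHalfPlane) : (0 : BergmanSpace ℓ) z = 0 := rfl

theorem integrable_mul (h k : BergmanSpace ℓ) :
    Integrable (fun z => starRingEnd ℂ (h z) * k z) (bergmanMeasure ℓ) :=
  MemLp.integrable_mul (p := 2) (q := 2) h.memLp.star k.memLp

/-- The inner product `⟪h, k⟫ = π⁻¹ ∫∫ x ^ ℓ conj (h (x + i y)) k (x + i y) dx dy`
(conjugate-linear in the first argument). -/
abbrev innerCore : InnerProductSpace.Core ℂ (BergmanSpace ℓ) where
  inner h k := ∫ z, starRingEnd ℂ (h z) * k z ∂(bergmanMeasure ℓ)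
  conj_inner_symm h k := by
    rw [← integral_conj]
    simp [mul_comm]
  re_inner_nonneg h := by
    have : ∀ z, starRingEnd ℂ (h z) * h z = ((‖h z‖ ^ 2 : ℝ) : ℂ) := fun z => by
      rw [Complex.conj_mul', Complex.ofReal_pow]
    simp only [this]
    rw [integral_complex_ofReal]
    simpa using integral_nonneg fun z => sq_nonneg ‖h z‖
  add_left h k l := by
    simp only [add_apply, map_add, add_mul]
    exact integral_add (integrable_mul h l) (integrable_mul k l)
  smul_left h k c := by
    simp only [smul_apply, map_mul, mul_assoc]
    exact integral_const_mul _ _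
  definite h h0 := by
    have hz : ∀ z, starRingEnd ℂ (h z) * h z = ((‖h z‖ ^ 2 : ℝ) : ℂ) := fun z => by
      rw [Complex.conj_mul', Complex.ofReal_pow]
    have hi := integrable_mul h h
    simp only [hz] at h0 hi
    rw [integral_complex_ofReal, Complex.ofReal_eq_zero] at h0
    have hi' : Integrable (fun z => ‖h z‖ ^ 2) (bergmanMeasure ℓ) := by
      have := hi.re
      simpa only [RCLike.re_eq_complex_re, Complex.ofReal_re] using this
    rw [integral_eq_zero_iff_of_nonneg (fun z => sq_nonneg ‖h z‖) hi'] at h0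
    have hc : Continuous (fun z => ‖h z‖ ^ 2) := (h.analytic.continuous.norm).pow 2
    have := (hc.ae_eq_iff_eq (bergmanMeasure ℓ) continuous_const).1 h0
    refine ext fun z => ?_
    have hz0 : ‖h z‖ ^ 2 = 0 := congrFun this z
    simpa using hz0

instance : NormedAddCommGroup (BergmanSpace ℓ) :=
  innerCore.toNormedAddCommGroup

instance : InnerProductSpace ℂ (BergmanSpace ℓ) := InnerProductSpace.ofCore innerCore.toCore

theorem norm_sq_eq_integral (h : BergmanSpace ℓ) :
    ‖h‖ ^ 2 = ∫ z, ‖h z‖ ^ 2 ∂(bergmanMeasure ℓ) := by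
  have h1 : ‖h‖ ^ 2 = RCLike.re (inner ℂ h h) := (inner_self_eq_norm_sq (𝕜 := ℂ) h).symm
  have h2 : inner ℂ h h = ∫ z, starRingEnd ℂ (h z) * h z ∂(bergmanMeasure ℓ) := rfl
  have hz : ∀ z, starRingEnd ℂ (h z) * h z = ((‖h z‖ ^ 2 : ℝ) : ℂ) := fun z => by
    rw [Complex.conj_mul', Complex.ofReal_pow]
  rw [h1, h2]
  simp only [hz]
  rw [integral_complex_ofReal]
  simp

/-- The Bergman norm is given by the usual area integral. -/
theorem norm_sq_eq (h : BergmanSpace ℓ) :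
    ‖h‖ ^ 2 = Real.pi⁻¹ * ∫ z in {z : ℂ | 0 < z.re},
      z.re ^ ℓ * ‖(if hz : 0 < z.re then h ⟨z, hz⟩ else 0 : ℂ)‖ ^ 2 := by
  rw [norm_sq_eq_integral, bergmanMeasure, integral_withDensity_eq_integral_toReal_smul
    (by fun_prop) (by simp), ← integral_subtype_comap measurableSet_rhp, ← integral_const_mul]
  refine integral_congr_ae (Filter.Eventually.of_forall fun z => ?_)
  have hz : 0 < (z : ℂ).re := z.2
  have h0 : 0 ≤ Real.pi⁻¹ * (z : ℂ).re ^ ℓ := by positivity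
  simp only [ENNReal.toReal_ofReal h0, hz, dite_true, smul_eq_mul]
  ring

end BergmanSpace

/-- The maximal weighted composition operator `W_{f,g,max}` on `A²_ℓ`: its domain consists of all
`h ∈ A²_ℓ` with `f · (h ∘ g) ∈ A²_ℓ`, and it sends `h` to `f · (h ∘ g)`. -/
def maxWeightedComposition (ℓ : ℕ) (f : RightHalfPlane → ℂ)
    (g : RightHalfPlane → RightHalfPlane) : BergmanSpace ℓ →ₗ.[ℂ] BergmanSpace ℓ where
  domain :=
    { carrier := {h | (fun z => f z * h (g z)) ∈ bergmanSubmodule ℓ}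
      zero_mem' := by
        have : (fun z => f z * (0 : BergmanSpace ℓ) (g z)) = 0 := funext fun z => by simp
        simp only [Set.mem_ofPred_eq, this]
        exact Submodule.zero_mem _
      add_mem' := by
        intro a b ha hb
        have : (fun z => f z * (a + b) (g z)) = (fun z => f z * a (g z)) + fun z => f z * b (g z) :=
          funext fun z => by simp [mul_add]
        simp only [Set.mem_ofPred_eq, this]
        exact Submodule.add_mem _ ha hb
      smul_mem' := by
        intro c a ha
        have : (fun z => f z * (c • a) (g z)) = c • fun z => f z * a (g z) :=
          funext fun z => by simp [mul_left_comm]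
        simp only [Set.mem_ofPred_eq, this]
        exact Submodule.smul_mem _ c ha }
  toFun :=
    { toFun := fun h => ⟨fun z => f z * h.1 (g z), h.2⟩
      map_add' := fun a b => BergmanSpace.ext fun z => mul_add (f z) (a.1 (g z)) (b.1 (g z))
      map_smul' := fun c a => BergmanSpace.ext fun z => mul_left_comm (f z) c (a.1 (g z)) }

/-- A (partially defined) linear operator on an inner product space is unitary if it is everywhere
defined and is a linear isometry of the space onto itself. -/
def IsUnitaryOperator {E : Type*} [NormedAddCommGroup E] [InnerProductSpace ℂ E]
    (T : E →ₗ.[ℂ] E) : Prop :=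
  T.domain = ⊤ ∧ (∀ x y : T.domain, inner ℂ (T x) (T y) = inner ℂ (x : E) (y : E)) ∧
    Function.Surjective T

end

open MeasureTheory

noncomputable section

/-! Necessity comes from reproducing kernels. Up to a constant, the kernel of the space at `w` is
`k_w(z) = (z + conj w)^(-(ℓ+2))`. The adjoint of `W` sends `k_w` to `conj (f w) • k_{g w}`, so `W W*
= 1` says that `q(z,w) = (g z + conj (g w)) / (z + conj w)` satisfies `q(z,w)^(ℓ+2) = f z * conj (f
w)` (`IsUnitaryOperator.add_conj_pow_eq`). Connectedness of the half-plane removes the power: `q`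
itself factorises as `q(z,w) q(1,1) = q(z,1) q(1,w)` (`add_conj_div_factor`). For `L(z) = q(1,1) /
q(z,1)` this becomes a functional equation that forces `L = 1 + M (z - 1)` with `Re M = |M|^2`
(`exists_affine_of_functional_equation`). Hence `g` is a Möbius map: `M = 0` gives the affine form,
and `M ≠ 0` means `Re (1/M) = 1` and gives the inversion. Then `f` is read off from the power
identity at `w = 1`.

Sufficiency is a change of variables: both families are automorphisms of the half-plane with `|g'|^2
(Re g)^ℓ = (Re z)^ℓ |f|^2`. -/

theorem Complex.abs_det_restrictScalars_toSpanSingleton (a : ℂ) :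
    |((ContinuousLinearMap.toSpanSingleton ℂ a).restrictScalars ℝ).det| = ‖a‖ ^ 2 := by
  have : ((ContinuousLinearMap.toSpanSingleton ℂ a).restrictScalars ℝ).det = ‖a‖ ^ 2 := by
    simp [ContinuousLinearMap.det, LinearMap.det_restrictScalars,
      Algebra.norm_complex_eq, Complex.normSq_eq_norm_sq]
  rw [this, abs_of_nonneg (by positivity)]

/-! ### Holomorphic change of variables and the Bergman measure. -/

section ChangeOfVariables

variable {E : Type*} [NormedAddCommGroup E] [NormedSpace ℝ E] {s : Set ℂ} {g g' : ℂ → ℂ}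

theorem integrableOn_image_iff_of_hasDerivAt (hs : MeasurableSet s)
    (hg : ∀ z ∈ s, HasDerivAt g (g' z) z) (hinj : Set.InjOn g s) (F : ℂ → E) :
    IntegrableOn F (g '' s) ↔ IntegrableOn (fun z => ‖g' z‖ ^ 2 • F (g z)) s := by
  rw [integrableOn_image_iff_integrableOn_abs_det_fderiv_smul volume hs
    (fun z hz => ((hg z hz).hasFDerivAt.restrictScalars ℝ).hasFDerivWithinAt) hinj]
  simp only [Complex.abs_det_restrictScalars_toSpanSingleton]

theorem setIntegral_image_of_hasDerivAt (hs : MeasurableSet s)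
    (hg : ∀ z ∈ s, HasDerivAt g (g' z) z) (hinj : Set.InjOn g s) (F : ℂ → E) :
    ∫ z in g '' s, F z = ∫ z in s, ‖g' z‖ ^ 2 • F (g z) := by
  rw [integral_image_eq_integral_abs_det_fderiv_smul volume hs
    (fun z hz => ((hg z hz).hasFDerivAt.restrictScalars ℝ).hasFDerivWithinAt) hinj]
  simp only [Complex.abs_det_restrictScalars_toSpanSingleton]

theorem integral_bergmanMeasure (ℓ : ℕ) (F : ℂ → E) :
    ∫ z : RightHalfPlane, F z ∂(bergmanMeasure ℓ) =
      ∫ z in {z : ℂ | 0 < z.re}, (Real.pi⁻¹ * z.re ^ ℓ) • F z := by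
  rw [bergmanMeasure, integral_withDensity_eq_integral_toReal_smul (by fun_prop) (by simp),
    ← integral_subtype_comap measurableSet_rhp]
  refine integral_congr_ae (Filter.Eventually.of_forall fun z => ?_)
  have hz : 0 < (z : ℂ).re := z.2
  have h0 : 0 ≤ Real.pi⁻¹ * (z : ℂ).re ^ ℓ := by positivity
  simp only [ENNReal.toReal_ofReal h0]

theorem integrable_bergmanMeasure_iff (ℓ : ℕ) (F : ℂ → E) :
    Integrable (fun z : RightHalfPlane => F z) (bergmanMeasure ℓ) ↔
      IntegrableOn (fun z => (Real.pi⁻¹ * z.re ^ ℓ) • F z) {z : ℂ | 0 < z.re} := by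
  rw [bergmanMeasure, integrable_withDensity_iff_integrable_smul' (by fun_prop) (by simp)]
  have he : MeasurableEmbedding (Subtype.val : RightHalfPlane → ℂ) :=
    MeasurableEmbedding.subtype_coe measurableSet_rhp
  rw [← Subtype.range_coe_subtype, IntegrableOn, ← he.map_comap, he.integrable_map_iff]
  refine integrable_congr (Filter.Eventually.of_forall fun z => ?_)
  have hz : 0 < (z : ℂ).re := z.2
  have h0 : 0 ≤ Real.pi⁻¹ * (z : ℂ).re ^ ℓ := by positivity
  simp only [ENNReal.toReal_ofReal h0, Function.comp]

end ChangeOfVariables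

/-! ### Mean value property on the disc. -/

/-- Supplies the integrability that Fubini needs in polar coordinates. -/
theorem integrableOn_polarCoord_target {F : ℂ → ℂ} (hF : Integrable F) :
    IntegrableOn (fun p : ℝ × ℝ => p.1 • F (Complex.polarCoord.symm p)) polarCoord.target := by
  have h1 : Integrable (fun p : ℝ × ℝ => F (Complex.measurableEquivRealProd.symm p)) :=
    (Complex.volume_preserving_equiv_real_prod.symm).integrable_comp_emb
      Complex.measurableEquivRealProd.symm.measurableEmbedding |>.2 hF
  have h2 := h1.integrableOn (s := polarCoord.symm '' polarCoord.target)
  rw [integrableOn_image_iff_integrableOn_abs_det_fderiv_smul volume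
    polarCoord.open_target.measurableSet
    (fun p _ => (hasFDerivAt_polarCoord_symm p).hasFDerivWithinAt) polarCoord.symm.injOn] at h2
  refine h2.congr_fun (fun p hp => ?_) polarCoord.open_target.measurableSet
  simp only [det_fderivPolarCoordSymm, Complex.measurableEquivRealProd_symm_polarCoord_symm_apply]
  rw [abs_of_pos hp.1]

theorem integral_angle_eq_zero {H : ℂ → ℂ} (hH : DifferentiableOn ℂ H (Metric.ball 0 1))
    (h0 : H 0 = 0) {r : ℝ} (hr0 : 0 < r) (hr : r < 1) :
    ∫ t in Set.Ioo (-Real.pi) Real.pi, H (Complex.polarCoord.symm (r, t)) = 0 := by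
  have h1 : Real.circleAverage H 0 r = H 0 := by
    refine DiffContOnCl.circleAverage (DifferentiableOn.diffContOnCl (hH.mono ?_))
    rw [abs_of_pos hr0, closure_ball _ hr0.ne']
    exact Metric.closedBall_subset_ball hr
  rw [h0, Real.circleAverage_def] at h1
  have h2 : ∫ t in (0 : ℝ)..2 * Real.pi, H (circleMap 0 r t) = 0 := by
    have := Real.pi_pos
    simpa [this.ne'] using h1
  have h3 : ∫ t in (-Real.pi)..Real.pi, H (circleMap 0 r t) = 0 := by
    have hp : Function.Periodic (fun t => H (circleMap 0 r t)) (2 * Real.pi) := fun t => by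
      simp only [periodic_circleMap 0 r t]
    have := hp.intervalIntegral_add_eq (-Real.pi) 0
    rw [zero_add, h2] at this
    rwa [show -Real.pi + 2 * Real.pi = Real.pi by ring] at this
  rw [intervalIntegral.integral_of_le (by linarith [Real.pi_pos]),
    integral_Ioc_eq_integral_Ioo] at h3
  rw [← h3]
  congr 1 with t
  rw [Complex.polarCoord_symm_apply, circleMap, zero_add, Complex.exp_mul_I,
    Complex.ofReal_cos, Complex.ofReal_sin]

/-- The mean value property for a radial weight on the unit disc. -/
theorem setIntegral_ball_radial_mul {H : ℂ → ℂ} {ρ : ℝ → ℝ}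
    (hH : DifferentiableOn ℂ H (Metric.ball 0 1))
    (hρ : IntegrableOn (fun z : ℂ => ρ ‖z‖) (Metric.ball 0 1))
    (hi : IntegrableOn (fun z => (ρ ‖z‖ : ℂ) * H z) (Metric.ball 0 1)) :
    ∫ z in Metric.ball (0 : ℂ) 1, (ρ ‖z‖ : ℂ) * H z =
      ((∫ z in Metric.ball (0 : ℂ) 1, ρ ‖z‖ : ℝ) : ℂ) * H 0 := by
  have hρ' : IntegrableOn (fun z : ℂ => (ρ ‖z‖ : ℂ) * H 0) (Metric.ball 0 1) :=
    hρ.ofReal.mul_const _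
  -- Subtracting the constant `H 0` reduces the claim to a vanishing integral, which can be checked
  -- circle by circle.
  rw [← integral_complex_ofReal, ← integral_mul_const, ← sub_eq_zero,
    ← integral_sub hi hρ', ← integral_indicator measurableSet_ball,
    ← Complex.integral_comp_polarCoord_symm]
  have hint := integrableOn_polarCoord_target
    ((integrable_indicator_iff measurableSet_ball).2 (hi.sub hρ'))
  have ht : polarCoord.target = Set.Ioi (0 : ℝ) ×ˢ Set.Ioo (-Real.pi) Real.pi := rfl
  rw [ht] at hint ⊢
  rw [Measure.volume_eq_prod] at hint ⊢
  refine (setIntegral_prod _ hint).trans ?_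
  -- On a circle of radius `r < 1` the weight is constant and `H - H 0` has mean zero; for `r ≥ 1`
  -- the indicator vanishes.
  refine setIntegral_eq_zero_of_forall_eq_zero fun r (hr : 0 < r) => ?_
  have hn : ∀ t, ‖Complex.polarCoord.symm (r, t)‖ = r := fun t => by
    rw [Complex.norm_polarCoord_symm, abs_of_pos hr]
  by_cases h1 : r < 1
  · have hm : ∀ t, Complex.polarCoord.symm (r, t) ∈ Metric.ball (0 : ℂ) 1 := fun t => by
      simpa only [mem_ball_zero_iff, hn] using h1
    simp only [Set.indicator_of_mem (hm _), Pi.sub_apply, hn, ← mul_sub]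
    simp only [integral_smul, integral_const_mul]
    rw [integral_angle_eq_zero (H := fun z => H z - H 0) (hH.sub_const _) (sub_self _) hr h1]
    simp
  · have hm : ∀ t, Complex.polarCoord.symm (r, t) ∉ Metric.ball (0 : ℂ) 1 := fun t => by
      simpa only [mem_ball_zero_iff, hn] using h1
    simp only [Set.indicator_of_notMem (hm _), smul_zero, integral_zero]

/-! ### Möbius transfer from the disc to the half-plane. -/

open ComplexConjugate in
/-- The Möbius map of the unit disc onto the right half-plane that sends `0` to `w`. -/
def discToRHP (w ζ : ℂ) : ℂ := (w - conj w * ζ) / (1 + ζ)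

section DiscToRHP

variable {w ζ : ℂ}

theorem one_add_ne_zero_of_mem_ball (hζ : ζ ∈ Metric.ball (0 : ℂ) 1) : 1 + ζ ≠ 0 := by
  intro h
  rw [mem_ball_zero_iff, eq_neg_of_add_eq_zero_right h] at hζ
  simp at hζ

theorem add_conj_ne_zero {z w : ℂ} (hz : 0 < z.re) (hw : 0 < w.re) :
    z + starRingEnd ℂ w ≠ 0 := by
  intro h
  have := congrArg Complex.re h
  simp at this
  linarith

theorem discToRHP_zero : discToRHP w 0 = w := by simp [discToRHP]

theorem discToRHP_add_conj (hζ : ζ ∈ Metric.ball (0 : ℂ) 1) :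
    discToRHP w ζ + starRingEnd ℂ w = ((2 * w.re : ℝ) : ℂ) / (1 + ζ) := by
  have h1 := one_add_ne_zero_of_mem_ball hζ
  have h2 := Complex.add_conj w
  rw [discToRHP, ← h2]
  field_simp
  ring

theorem hasDerivAt_discToRHP (hζ : ζ ∈ Metric.ball (0 : ℂ) 1) :
    HasDerivAt (discToRHP w) (-((2 * w.re : ℝ) : ℂ) / (1 + ζ) ^ 2) ζ := by
  have h1 := one_add_ne_zero_of_mem_ball hζ
  have h2 := Complex.add_conj w
  have h3 : HasDerivAt (fun ζ : ℂ => w - starRingEnd ℂ w * ζ) (-(starRingEnd ℂ w)) ζ := by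
    simpa using ((hasDerivAt_id ζ).const_mul (starRingEnd ℂ w)).const_sub w
  have h4 : HasDerivAt (fun ζ : ℂ => 1 + ζ) 1 ζ := (hasDerivAt_id ζ).const_add 1
  convert! h3.div h4 h1 using 1
  rw [← h2]
  ring

theorem re_discToRHP (hζ : ζ ∈ Metric.ball (0 : ℂ) 1) :
    (discToRHP w ζ).re = w.re * (1 - ‖ζ‖ ^ 2) / ‖1 + ζ‖ ^ 2 := by
  have h1 : Complex.normSq (1 + ζ) ≠ 0 :=
    (Complex.normSq_pos.2 (one_add_ne_zero_of_mem_ball hζ)).ne'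
  rw [discToRHP, Complex.div_re, ← Complex.normSq_eq_norm_sq, ← Complex.normSq_eq_norm_sq,
    ← add_div]
  congr 1
  simp [Complex.normSq_apply]
  ring

theorem injOn_discToRHP (hw : 0 < w.re) : Set.InjOn (discToRHP w) (Metric.ball 0 1) := by
  intro a ha b hb hab
  have h := discToRHP_add_conj (w := w) ha
  rw [hab, discToRHP_add_conj hb] at h
  have h1 := one_add_ne_zero_of_mem_ball ha
  have h2 := one_add_ne_zero_of_mem_ball hb
  have h3 : ((2 * w.re : ℝ) : ℂ) ≠ 0 := Complex.ofReal_ne_zero.2 (by positivity)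
  rw [div_eq_div_iff h2 h1] at h
  exact add_left_cancel (mul_left_cancel₀ h3 h)

theorem re_discToRHP_pos (hw : 0 < w.re) (hζ : ζ ∈ Metric.ball (0 : ℂ) 1) :
    0 < (discToRHP w ζ).re := by
  have h1 := norm_pos_iff.2 (one_add_ne_zero_of_mem_ball hζ)
  rw [mem_ball_zero_iff] at hζ
  rw [re_discToRHP (mem_ball_zero_iff.2 hζ)]
  have : 0 < 1 - ‖ζ‖ ^ 2 := by nlinarith [norm_nonneg ζ]
  positivity

theorem image_discToRHP (hw : 0 < w.re) :
    discToRHP w '' Metric.ball 0 1 = {z : ℂ | 0 < z.re} := by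
  refine Set.Subset.antisymm ?_ ?_
  · rintro _ ⟨ζ, hζ, rfl⟩
    exact re_discToRHP_pos hw hζ
  · intro z (hz : 0 < z.re)
    have h1 := add_conj_ne_zero hz hw
    have h2 := add_conj_ne_zero hw hw
    -- The solution `ζ` of `discToRHP w ζ = z`. It lies in the disc because `|z + conj w|^2 - |w -
    -- z|^2 = 4 Re z Re w`.
    refine ⟨(w - z) / (z + starRingEnd ℂ w), ?_, ?_⟩
    · rw [mem_ball_zero_iff, norm_div, div_lt_one (norm_pos_iff.2 h1)]
      refine lt_of_pow_lt_pow_left₀ 2 (norm_nonneg _) ?_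
      rw [← Complex.normSq_eq_norm_sq, ← Complex.normSq_eq_norm_sq, Complex.normSq_apply,
        Complex.normSq_apply]
      simp only [Complex.sub_re, Complex.sub_im, Complex.add_re, Complex.add_im, Complex.conj_re,
        Complex.conj_im]
      nlinarith [mul_pos hz hw]
    · have h3 : 1 + (w - z) / (z + starRingEnd ℂ w) =
          (w + starRingEnd ℂ w) / (z + starRingEnd ℂ w) := by
        field_simp
        ring
      rw [discToRHP, h3]
      field_simp
      ring

end DiscToRHP

/-! ### Reproducing kernel. -/

theorem differentiableOn_inv_add_conj_pow {w : ℂ} (hw : 0 < w.re) (n : ℕ) :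
    DifferentiableOn ℂ (fun z : ℂ => ((z + starRingEnd ℂ w) ^ n)⁻¹) {z : ℂ | 0 < z.re} :=
  ((differentiableOn_id.add_const _).pow n).inv fun _ hz => pow_ne_zero _ (add_conj_ne_zero hz hw)

theorem integrableOn_radial_weight (ℓ : ℕ) :
    IntegrableOn (fun ζ : ℂ => (1 - ‖ζ‖ ^ 2) ^ ℓ) (Metric.ball 0 1) :=
  ((by fun_prop : Continuous fun ζ : ℂ => (1 - ‖ζ‖ ^ 2) ^ ℓ).continuousOn.integrableOn_compact
    (isCompact_closedBall 0 1)).mono_set Metric.ball_subset_closedBall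

/-- The constant `κ` with `⟪(z + conj w) ^ (-(ℓ + 2)), h⟫ = κ h(w)` for `h` in `A²_ℓ`. -/
def bergmanConst (ℓ : ℕ) : ℝ :=
  (Real.pi * 2 ^ ℓ)⁻¹ * ∫ ζ in Metric.ball (0 : ℂ) 1, (1 - ‖ζ‖ ^ 2) ^ ℓ

/-- The pullback of the Bergman weight to the disc. -/
theorem norm_sq_deriv_discToRHP_mul {w ζ : ℂ} (hζ : ζ ∈ Metric.ball (0 : ℂ) 1)
    (ℓ : ℕ) :
    ‖-((2 * w.re : ℝ) : ℂ) / (1 + ζ) ^ 2‖ ^ 2 * (Real.pi⁻¹ * (discToRHP w ζ).re ^ ℓ) =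
      (Real.pi * 2 ^ ℓ)⁻¹ * (2 * w.re) ^ (ℓ + 2) * (1 - ‖ζ‖ ^ 2) ^ ℓ / ‖1 + ζ‖ ^ (2 * (ℓ + 2)) := by
  have h1 := norm_pos_iff.2 (one_add_ne_zero_of_mem_ball hζ)
  rw [re_discToRHP hζ, norm_div, norm_neg, norm_pow, Complex.norm_real, div_pow, div_pow,
    Real.norm_eq_abs, sq_abs]
  simp only [mul_pow]
  field_simp
  ring

/-- `z ↦ (z + conj w) ^ (-(ℓ + 2))`, which is the reproducing kernel of `A²_ℓ` at `w` up to a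
constant factor. -/
def bergmanKernel (ℓ : ℕ) (w : RightHalfPlane) : BergmanSpace ℓ :=
  ⟨fun z => (((z : ℂ) + starRingEnd ℂ (w : ℂ)) ^ (ℓ + 2))⁻¹,
    ⟨_, differentiableOn_inv_add_conj_pow w.2 _, fun _ => rfl⟩, by
    have hc : Continuous fun z : RightHalfPlane =>
        (((z : ℂ) + starRingEnd ℂ (w : ℂ)) ^ (ℓ + 2))⁻¹ :=
      IsAnalyticRHP.continuous ⟨_, differentiableOn_inv_add_conj_pow w.2 _, fun _ => rfl⟩
    rw [memLp_two_iff_integrable_sq_norm hc.aestronglyMeasurable,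
      integrable_bergmanMeasure_iff ℓ
        (fun z : ℂ => ‖((z + starRingEnd ℂ (w : ℂ)) ^ (ℓ + 2))⁻¹‖ ^ 2), ← image_discToRHP w.2,
      integrableOn_image_iff_of_hasDerivAt measurableSet_ball
        (fun ζ hζ => hasDerivAt_discToRHP hζ) (injOn_discToRHP w.2)]
    refine IntegrableOn.congr_fun ((integrableOn_radial_weight ℓ).const_mul
      ((Real.pi * 2 ^ ℓ)⁻¹ * ((2 * (w : ℂ).re) ^ (ℓ + 2))⁻¹))
      (fun ζ hζ => ?_) measurableSet_ball
    have h1 := norm_pos_iff.2 (one_add_ne_zero_of_mem_ball hζ)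
    have hw := w.2
    simp only [smul_eq_mul]
    rw [← mul_assoc, norm_sq_deriv_discToRHP_mul hζ, discToRHP_add_conj hζ, norm_inv, norm_pow,
      norm_div, Complex.norm_real, Real.norm_of_nonneg (by positivity), div_pow, pow_mul' ‖1 + ζ‖]
    field_simp⟩

theorem bergmanKernel_apply (ℓ : ℕ) (w z : RightHalfPlane) :
    bergmanKernel ℓ w z = (((z : ℂ) + starRingEnd ℂ (w : ℂ)) ^ (ℓ + 2))⁻¹ := rfl

theorem BergmanSpace.inner_def {ℓ : ℕ} (h k : BergmanSpace ℓ) :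
    inner ℂ h k = ∫ z, starRingEnd ℂ (h z) * k z ∂(bergmanMeasure ℓ) := rfl

/-- Pulled back to the disc by the Möbius map with `0 ↦ w`, the integrand is a radial weight times a
holomorphic function whose value at `0` is `h w`, so the mean value property applies. The constant
is never evaluated, since it occurs on both sides where the lemma is used. -/
theorem inner_bergmanKernel {ℓ : ℕ} (w : RightHalfPlane) (h : BergmanSpace ℓ) :
    inner ℂ (bergmanKernel ℓ w) h = bergmanConst ℓ * h w := by
  obtain ⟨H, hH, hHh⟩ := h.analytic
  have hint := BergmanSpace.integrable_mul (bergmanKernel ℓ w) h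
  rw [BergmanSpace.inner_def]
  simp only [← hHh, bergmanKernel_apply] at hint ⊢
  rw [integral_bergmanMeasure ℓ
      (fun z => starRingEnd ℂ (((z + starRingEnd ℂ (w : ℂ)) ^ (ℓ + 2))⁻¹) * H z),
    ← image_discToRHP w.2, setIntegral_image_of_hasDerivAt measurableSet_ball
        (fun ζ hζ => hasDerivAt_discToRHP hζ) (injOn_discToRHP w.2)]
  rw [integrable_bergmanMeasure_iff ℓ
      (fun z => starRingEnd ℂ (((z + starRingEnd ℂ (w : ℂ)) ^ (ℓ + 2))⁻¹) * H z),
    ← image_discToRHP w.2, integrableOn_image_iff_of_hasDerivAt measurableSet_ball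
        (fun ζ hζ => hasDerivAt_discToRHP hζ) (injOn_discToRHP w.2)] at hint
  have hκ : ((Real.pi * 2 ^ ℓ : ℝ) : ℂ)⁻¹ ≠ 0 :=
    inv_ne_zero (Complex.ofReal_ne_zero.2 (by positivity))
  -- The conjugated kernel contributes `conj (1 + ζ)^(ℓ+2) / (2 Re w)^(ℓ+2)`. It cancels the
  -- antiholomorphic half of `|1 + ζ|^(-2(ℓ+2))` and the powers of `Re w`.
  have key : ∀ ζ ∈ Metric.ball (0 : ℂ) 1,
      ‖-((2 * (w : ℂ).re : ℝ) : ℂ) / (1 + ζ) ^ 2‖ ^ 2 •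
        (Real.pi⁻¹ * (discToRHP w ζ).re ^ ℓ) •
          (starRingEnd ℂ (((discToRHP w ζ + starRingEnd ℂ (w : ℂ)) ^ (ℓ + 2))⁻¹) *
            H (discToRHP w ζ)) =
      ((Real.pi * 2 ^ ℓ : ℝ) : ℂ)⁻¹ * ((((1 - ‖ζ‖ ^ 2) ^ ℓ : ℝ) : ℂ) *
        (H (discToRHP w ζ) / (1 + ζ) ^ (ℓ + 2))) := by
    intro ζ hζ
    have h1 := one_add_ne_zero_of_mem_ball hζ
    have h2 : starRingEnd ℂ (1 + ζ) ≠ 0 := (map_ne_zero _).2 h1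
    have hw : (((w : ℂ).re : ℝ) : ℂ) ≠ 0 := Complex.ofReal_ne_zero.2 w.2.ne'
    rw [smul_smul, norm_sq_deriv_discToRHP_mul hζ, discToRHP_add_conj hζ, Complex.real_smul,
      map_inv₀, map_pow, map_div₀, Complex.conj_ofReal]
    have hpi : (Real.pi : ℂ) ≠ 0 := Complex.ofReal_ne_zero.2 Real.pi_ne_zero
    have hn : ((‖1 + ζ‖ : ℝ) : ℂ) ^ (2 * (ℓ + 2)) =
        starRingEnd ℂ (1 + ζ) ^ (ℓ + 2) * (1 + ζ) ^ (ℓ + 2) := by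
      rw [pow_mul, ← Complex.conj_mul', mul_pow]
    push_cast
    rw [hn]
    generalize starRingEnd ℂ (1 + ζ) = ζ' at h2 ⊢
    simp only [div_pow, mul_pow]
    field_simp
  rw [setIntegral_congr_fun measurableSet_ball key]
  have hint2 := (integrableOn_congr_fun key measurableSet_ball).1 hint
  have hint3 : IntegrableOn (fun ζ : ℂ => (((1 - ‖ζ‖ ^ 2) ^ ℓ : ℝ) : ℂ) *
        (H (discToRHP w ζ) / (1 + ζ) ^ (ℓ + 2))) (Metric.ball 0 1) := by
    have := hint2.const_mul (((Real.pi * 2 ^ ℓ : ℝ) : ℂ)⁻¹)⁻¹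
    simp only [inv_mul_cancel_left₀ hκ] at this
    exact this
  rw [integral_const_mul]
  have hd : DifferentiableOn ℂ (fun ζ : ℂ => H (discToRHP w ζ) / (1 + ζ) ^ (ℓ + 2))
      (Metric.ball 0 1) := by
    refine DifferentiableOn.div ?_ ((differentiableOn_id.const_add 1).pow _)
      fun ζ hζ => pow_ne_zero _ (one_add_ne_zero_of_mem_ball hζ)
    exact hH.comp
      (fun ζ hζ => (hasDerivAt_discToRHP hζ).differentiableAt.differentiableWithinAt)
      (fun ζ hζ => re_discToRHP_pos w.2 hζ)
  rw [setIntegral_ball_radial_mul (ρ := fun r => (1 - r ^ 2) ^ ℓ) hd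
    (integrableOn_radial_weight ℓ) hint3, discToRHP_zero, bergmanConst]
  push_cast
  simp [mul_assoc]

/-! ### Necessity: kernel identity and functional equation. -/

section Necessity

variable {ℓ : ℕ} {f : RightHalfPlane → ℂ} {g : RightHalfPlane → RightHalfPlane}

theorem maxWeightedComposition_apply (h : (maxWeightedComposition ℓ f g).domain)
    (z : RightHalfPlane) :
    (maxWeightedComposition ℓ f g h) z = f z * (h : BergmanSpace ℓ) (g z) := rfl

/-- A unitary weighted composition operator transforms the reproducing kernel. -/
theorem IsUnitaryOperator.bergmanKernel_eq
    (hU : IsUnitaryOperator (maxWeightedComposition ℓ f g)) (z w : RightHalfPlane) :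
    bergmanKernel ℓ w z = f z * starRingEnd ℂ (f w) * bergmanKernel ℓ (g w) (g z) := by
  obtain ⟨hdom, hinner, hsurj⟩ := hU
  obtain ⟨u, hu⟩ := hsurj (bergmanKernel ℓ w)
  -- The preimage of `k_w` is its image under the adjoint, found by testing against every `h`: `⟪u,
  -- h⟫ = ⟪W u, W h⟫ = ⟪k_w, W h⟫`.
  have hu' : (u : BergmanSpace ℓ) = starRingEnd ℂ (f w) • bergmanKernel ℓ (g w) := by
    refine ext_inner_right ℂ fun h => ?_
    have hh : h ∈ (maxWeightedComposition ℓ f g).domain := hdom ▸ Submodule.mem_top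
    rw [inner_smul_left, inner_bergmanKernel, Complex.conj_conj, ← hinner u ⟨h, hh⟩, hu,
      inner_bergmanKernel, maxWeightedComposition_apply]
    ring
  rw [← hu, maxWeightedComposition_apply, hu', BergmanSpace.smul_apply, mul_assoc]

theorem IsUnitaryOperator.add_conj_pow_eq
    (hU : IsUnitaryOperator (maxWeightedComposition ℓ f g)) (z w : RightHalfPlane) :
    (((g z : ℂ) + starRingEnd ℂ (g w : ℂ)) / ((z : ℂ) + starRingEnd ℂ (w : ℂ))) ^ (ℓ + 2) =
      f z * starRingEnd ℂ (f w) := by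
  have h := hU.bergmanKernel_eq z w
  have h1 := pow_ne_zero (ℓ + 2) (add_conj_ne_zero z.2 w.2)
  have h2 := pow_ne_zero (ℓ + 2) (add_conj_ne_zero (g z).2 (g w).2)
  rw [bergmanKernel_apply, bergmanKernel_apply] at h
  rw [div_pow, div_eq_mul_inv, h]
  field_simp

instance : PreconnectedSpace RightHalfPlane :=
  isPreconnected_iff_preconnectedSpace.1 (convex_halfSpace_re_gt 0).isPreconnected

/-- The `n`-th roots of unity form a finite, hence discrete, set, so a continuous map from a
preconnected space into them is constant. -/
theorem eq_one_of_continuous_of_pow_eq_one {X : Type*} [TopologicalSpace X] [PreconnectedSpace X]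
    {n : ℕ} (hn : n ≠ 0) {r : X → ℂ} (hr : Continuous r) (hpow : ∀ x, r x ^ n = 1) {x₀ : X}
    (h0 : r x₀ = 1) (x : X) : r x = 1 := by
  have hfin : {c : ℂ | c ^ n = 1}.Finite := by
    refine (Polynomial.nthRootsFinset n (1 : ℂ)).finite_toSet.subset fun c hc => ?_
    simpa [Polynomial.mem_nthRootsFinset (Nat.pos_of_ne_zero hn)] using! hc
  rw [← h0]
  exact isPreconnected_univ.constant_of_mapsTo hfin.isDiscrete hr.continuousOn (fun y _ => hpow y)
    (Set.mem_univ x) (Set.mem_univ x₀)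

/-- The point `1` of the right half-plane. -/
def RightHalfPlane.one : RightHalfPlane := ⟨1, by simp⟩

/-- The polarised distortion of `g` factorises once one of its powers does. -/
theorem add_conj_div_factor {n : ℕ} (hn : n ≠ 0)
    (hg : Continuous fun z => (g z : ℂ))
    (h : ∀ z w : RightHalfPlane,
      (((g z : ℂ) + starRingEnd ℂ (g w : ℂ)) / ((z : ℂ) + starRingEnd ℂ (w : ℂ))) ^ n =
        f z * starRingEnd ℂ (f w)) (e z w : RightHalfPlane) :
    (((g z : ℂ) + starRingEnd ℂ (g w : ℂ)) / ((z : ℂ) + starRingEnd ℂ (w : ℂ))) *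
      (((g e : ℂ) + starRingEnd ℂ (g e : ℂ)) / ((e : ℂ) + starRingEnd ℂ (e : ℂ))) =
    (((g z : ℂ) + starRingEnd ℂ (g e : ℂ)) / ((z : ℂ) + starRingEnd ℂ (e : ℂ))) *
      (((g e : ℂ) + starRingEnd ℂ (g w : ℂ)) / ((e : ℂ) + starRingEnd ℂ (w : ℂ))) := by
  set q : RightHalfPlane → RightHalfPlane → ℂ := fun z w =>
    ((g z : ℂ) + starRingEnd ℂ (g w : ℂ)) / ((z : ℂ) + starRingEnd ℂ (w : ℂ)) with hq
  have hq0 : ∀ z w, q z w ≠ 0 := fun z w =>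
    div_ne_zero (add_conj_ne_zero (g z).2 (g w).2) (add_conj_ne_zero z.2 w.2)
  have hqc : ∀ w, Continuous fun z => q z w := fun w =>
    (hg.add continuous_const).div (continuous_subtype_val.add continuous_const)
      fun z => add_conj_ne_zero z.2 w.2
  have hqn : ∀ z w, q z w ^ n = f z * starRingEnd ℂ (f w) := h
  have hf : ∀ z, f z ≠ 0 := fun z hz => pow_ne_zero n (hq0 z z) (by rw [hqn, hz, zero_mul])
  -- All factors of `f` cancel in the `n`-th power of this cross-ratio, and it equals `1` at `z =
  -- e`.
  have := eq_one_of_continuous_of_pow_eq_one hn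
    (r := fun z => q z w * q e e / (q z e * q e w)) (x₀ := e)
    (((hqc w).mul continuous_const).div ((hqc e).mul continuous_const)
      fun z => mul_ne_zero (hq0 _ _) (hq0 _ _))
    (fun z => by
      have h1 := hf z
      have h2 := hf e
      have h3 := (map_ne_zero (starRingEnd ℂ)).2 (hf e)
      have h4 := (map_ne_zero (starRingEnd ℂ)).2 (hf w)
      rw [div_pow, mul_pow, mul_pow, hqn, hqn, hqn, hqn]
      field_simp)
    (by
      have h1 := hq0 e e
      have h2 := hq0 e w
      field_simp) z
  exact (div_eq_one_iff_eq (mul_ne_zero (hq0 _ _) (hq0 _ _))).1 this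

/-- Solutions of the functional equation to which the unitarity condition reduces. -/
theorem exists_affine_of_functional_equation {L : RightHalfPlane → ℂ}
    (h : ∀ z w : RightHalfPlane, ((z : ℂ) + 1) * starRingEnd ℂ (L w) +
      (starRingEnd ℂ (w : ℂ) + 1) * L z - 2 * (L z * starRingEnd ℂ (L w)) =
        (z : ℂ) + starRingEnd ℂ (w : ℂ)) :
    ∃ M : ℂ, M + starRingEnd ℂ M = 2 * (M * starRingEnd ℂ M) ∧
      ∀ z : RightHalfPlane, L z = 1 + M * ((z : ℂ) - 1) := by
  -- Fixing `w` makes the equation linear in `L z`. The choice `w = 1` is useless: the equation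
  -- forces `L 1 = 1`, and then the coefficient of `L z` vanishes. Any other point would serve.
  set p : RightHalfPlane := ⟨2, by simp⟩ with hp
  have hpv : (p : ℂ) = 2 := rfl
  set b := starRingEnd ℂ (L p) with hb
  have hlin : ∀ z : RightHalfPlane, ((z : ℂ) + 1) * b + (3 - 2 * b) * L z = (z : ℂ) + 2 :=
    fun z => by
      have := h z p
      rw [hpv, map_ofNat] at this
      linear_combination this
  have hb0 : 3 - 2 * b ≠ 0 := fun h0 => by
    have := hlin p
    rw [h0, hpv] at this
    have h1 : (1 : ℂ) / 2 = 0 := by linear_combination this + 3 / 2 * h0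
    norm_num at h1
  have hL : ∀ z : RightHalfPlane, L z = 1 + (1 - b) / (3 - 2 * b) * ((z : ℂ) - 1) := fun z => by
    have hd : (3 - 2 * b) / (3 - 2 * b) = 1 := div_self hb0
    linear_combination (hlin z) / (3 - 2 * b) + (1 - L z) * hd
  refine ⟨_, ?_, hL⟩
  have h1 := h p p
  rw [hL p, hpv] at h1
  simp only [map_add, map_mul, map_one, map_sub, map_ofNat] at h1 ⊢
  linear_combination h1

end Necessity

/-! ### Sufficiency: weighted automorphisms act unitarily. -/

section Sufficiency

/-- `g` is a biholomorphic self-map of the right half-plane, extended by `G` and with inverse `φ`,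
whose Jacobian compensates the weight `f`. -/
structure IsWeightedAutomorphism (ℓ : ℕ) (F G G' φ : ℂ → ℂ) : Prop where
  differentiableOn_weight : DifferentiableOn ℂ F {z : ℂ | 0 < z.re}
  weight_ne_zero : ∀ z : ℂ, 0 < z.re → F z ≠ 0
  hasDerivAt : ∀ z : ℂ, 0 < z.re → HasDerivAt G (G' z) z
  differentiableOn_inv : DifferentiableOn ℂ φ {z : ℂ | 0 < z.re}
  re_pos : ∀ z : ℂ, 0 < z.re → 0 < (G z).re
  re_inv_pos : ∀ z : ℂ, 0 < z.re → 0 < (φ z).re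
  left_inv : ∀ z : ℂ, 0 < z.re → φ (G z) = z
  right_inv : ∀ z : ℂ, 0 < z.re → G (φ z) = z
  jacobian : ∀ z : ℂ, 0 < z.re → ‖G' z‖ ^ 2 * (G z).re ^ ℓ = z.re ^ ℓ * ‖F z‖ ^ 2

namespace IsWeightedAutomorphism

variable {ℓ : ℕ} {F G G' φ : ℂ → ℂ} {E : Type*} [NormedAddCommGroup E] [NormedSpace ℝ E]

theorem image_eq (H : IsWeightedAutomorphism ℓ F G G' φ) :
    G '' {z : ℂ | 0 < z.re} = {z : ℂ | 0 < z.re} := by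
  refine Set.Subset.antisymm ?_ fun z hz => ⟨φ z, H.re_inv_pos z hz, H.right_inv z hz⟩
  rintro _ ⟨z, hz, rfl⟩
  exact H.re_pos z hz

theorem injOn (H : IsWeightedAutomorphism ℓ F G G' φ) : Set.InjOn G {z : ℂ | 0 < z.re} :=
  Set.LeftInvOn.injOn (f₁' := φ) H.left_inv

theorem smul_eq (H : IsWeightedAutomorphism ℓ F G G' φ) (K : ℂ → E) {z : ℂ} (hz : 0 < z.re) :
    ‖G' z‖ ^ 2 • (Real.pi⁻¹ * (G z).re ^ ℓ) • K (G z) =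
      (Real.pi⁻¹ * z.re ^ ℓ) • ‖F z‖ ^ 2 • K (G z) := by
  rw [smul_smul, smul_smul]
  congr 1
  linear_combination Real.pi⁻¹ * H.jacobian z hz

theorem integral_comp (H : IsWeightedAutomorphism ℓ F G G' φ) (K : ℂ → E) :
    ∫ z : RightHalfPlane, ‖F z‖ ^ 2 • K (G z) ∂(bergmanMeasure ℓ) =
      ∫ z : RightHalfPlane, K z ∂(bergmanMeasure ℓ) := by
  rw [integral_bergmanMeasure ℓ (fun z => ‖F z‖ ^ 2 • K (G z)), integral_bergmanMeasure ℓ K]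
  conv_rhs => rw [← H.image_eq]
  rw [setIntegral_image_of_hasDerivAt measurableSet_rhp H.hasDerivAt H.injOn]
  exact setIntegral_congr_fun measurableSet_rhp fun z hz => (H.smul_eq K hz).symm

theorem integrable_comp_iff (H : IsWeightedAutomorphism ℓ F G G' φ) (K : ℂ → E) :
    Integrable (fun z : RightHalfPlane => ‖F z‖ ^ 2 • K (G z)) (bergmanMeasure ℓ) ↔
      Integrable (fun z : RightHalfPlane => K z) (bergmanMeasure ℓ) := by
  rw [integrable_bergmanMeasure_iff ℓ (fun z => ‖F z‖ ^ 2 • K (G z)),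
    integrable_bergmanMeasure_iff ℓ K]
  conv_rhs => rw [← H.image_eq]
  rw [integrableOn_image_iff_of_hasDerivAt measurableSet_rhp H.hasDerivAt H.injOn]
  exact integrableOn_congr_fun (fun z hz => (H.smul_eq K hz).symm) measurableSet_rhp

theorem differentiableOn (H : IsWeightedAutomorphism ℓ F G G' φ) :
    DifferentiableOn ℂ G {z : ℂ | 0 < z.re} :=
  fun z hz => (H.hasDerivAt z hz).differentiableAt.differentiableWithinAt

theorem mem_bergmanSubmodule_iff (H : IsWeightedAutomorphism ℓ F G G' φ) {K : ℂ → ℂ}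
    (hK : DifferentiableOn ℂ K {z : ℂ | 0 < z.re}) :
    (fun z : RightHalfPlane => F z * K (G z)) ∈ bergmanSubmodule ℓ ↔
      (fun z : RightHalfPlane => K z) ∈ bergmanSubmodule ℓ := by
  have h1 : IsAnalyticRHP fun z => K z := ⟨K, hK, fun _ => rfl⟩
  have h2 : IsAnalyticRHP fun z => F z * K (G z) :=
    ⟨fun z => F z * K (G z),
      H.differentiableOn_weight.mul (hK.comp H.differentiableOn H.re_pos), fun _ => rfl⟩
  refine (and_iff_right h2).trans (Iff.trans ?_ (and_iff_right h1).symm)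
  rw [memLp_two_iff_integrable_sq_norm h1.continuous.aestronglyMeasurable,
    memLp_two_iff_integrable_sq_norm h2.continuous.aestronglyMeasurable,
    ← H.integrable_comp_iff (fun z => ‖K z‖ ^ 2)]
  simp only [norm_mul, mul_pow, smul_eq_mul]

/-- The Jacobian condition makes the substitution `G` preserve square integrability and inner
products. Surjectivity uses the explicit preimage `(K / F) ∘ φ` of `K`. -/
theorem isUnitaryOperator (H : IsWeightedAutomorphism ℓ F G G' φ) {f : RightHalfPlane → ℂ}
    {g : RightHalfPlane → RightHalfPlane} (hf : ∀ z, f z = F z) (hg : ∀ z, (g z : ℂ) = G z) :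
    IsUnitaryOperator (maxWeightedComposition ℓ f g) := by
  refine ⟨?_, ?_, ?_⟩
  · refine Submodule.eq_top_iff'.2 fun h => ?_
    obtain ⟨K, hK, hKh⟩ := h.analytic
    change (fun z => f z * h (g z)) ∈ bergmanSubmodule ℓ
    simp only [← hKh, hf, hg]
    rw [H.mem_bergmanSubmodule_iff hK]
    simp only [hKh]
    exact h.2
  · intro x y
    obtain ⟨K, hK, hKh⟩ := (x : BergmanSpace ℓ).analytic
    obtain ⟨N, hN, hNh⟩ := (y : BergmanSpace ℓ).analytic
    rw [BergmanSpace.inner_def, BergmanSpace.inner_def]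
    change ∫ z, starRingEnd ℂ (f z * (x : BergmanSpace ℓ) (g z)) *
      (f z * (y : BergmanSpace ℓ) (g z)) ∂(bergmanMeasure ℓ) = _
    simp only [← hKh, ← hNh, hf, hg]
    rw [← H.integral_comp (fun z => starRingEnd ℂ (K z) * N z)]
    refine integral_congr_ae (Filter.Eventually.of_forall fun z => ?_)
    simp only [Complex.real_smul, map_mul]
    push_cast
    rw [← Complex.conj_mul']
    ring
  · intro k
    obtain ⟨K, hK, hKk⟩ := k.analytic
    have hd : DifferentiableOn ℂ (fun z => K (φ z) / F (φ z)) {z : ℂ | 0 < z.re} :=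
      (hK.comp H.differentiableOn_inv H.re_inv_pos).div
        (H.differentiableOn_weight.comp H.differentiableOn_inv H.re_inv_pos)
        fun z hz => H.weight_ne_zero _ (H.re_inv_pos z hz)
    have he : ∀ z : RightHalfPlane, F z * (K (φ (G z)) / F (φ (G z))) = k z := fun z => by
      rw [H.left_inv z z.2, mul_div_cancel₀ _ (H.weight_ne_zero z z.2), hKk]
    have hm := (H.mem_bergmanSubmodule_iff hd).1 (by simp only [he]; exact k.2)
    refine ⟨⟨⟨_, hm⟩, ?_⟩, ?_⟩
    · change (fun z : RightHalfPlane => f z * (K (φ (g z)) / F (φ (g z)))) ∈ bergmanSubmodule ℓ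
      simp only [hf, hg, he]
      exact k.2
    · refine BergmanSpace.ext fun z => ?_
      change f z * (K (φ (g z)) / F (φ (g z))) = k z
      rw [hf, hg, he]

end IsWeightedAutomorphism

end Sufficiency

/-! ### The two explicit families and the classification. -/

theorem rpow_two_div_of_sq_eq_pow {c S : ℝ} (hc : 0 ≤ c) (hS : 0 ≤ S) {ℓ : ℕ}
    (h : c ^ 2 = S ^ (ℓ + 2)) : c ^ (2 / ((ℓ : ℝ) + 2)) = S := by
  have hn : ((ℓ + 2 : ℕ) : ℝ) ≠ 0 := by positivity
  rw [div_eq_mul_inv, Real.rpow_mul hc, Real.rpow_two, h,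
    show (ℓ : ℝ) + 2 = ((ℓ + 2 : ℕ) : ℝ) by push_cast; rfl, Real.pow_rpow_inv_natCast hS (by simp)]

theorem rpow_two_div_pow {c : ℝ} (hc : 0 ≤ c) (ℓ : ℕ) :
    (c ^ (2 / ((ℓ : ℝ) + 2))) ^ (ℓ + 2) = c ^ 2 := by
  rw [← Real.rpow_natCast, ← Real.rpow_mul hc]
  push_cast
  rw [div_mul_cancel₀ _ (by positivity), Real.rpow_two]

/-- The derivative contributes `S^2` and the weight `S^ℓ`, whence the exponent `ℓ + 2` in `hSC`. -/
theorem isWeightedAutomorphism_affine (ℓ : ℕ) {C : ℂ} (hC : C ≠ 0) {S : ℝ} (hS : 0 < S)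
    (hSC : S ^ (ℓ + 2) = ‖C‖ ^ 2) (δ : ℝ) :
    IsWeightedAutomorphism ℓ (fun _ => C) (fun z => (S : ℂ) * z + Complex.I * (δ : ℂ))
      (fun _ => (S : ℂ)) (fun z => (z - Complex.I * (δ : ℂ)) / (S : ℂ)) where
  differentiableOn_weight := differentiableOn_const _
  weight_ne_zero _ _ := hC
  hasDerivAt z _ := by
    simpa using! ((hasDerivAt_id z).const_mul (S : ℂ)).add_const (Complex.I * (δ : ℂ))
  differentiableOn_inv := by fun_prop
  re_pos z hz := by simpa using mul_pos hS hz
  re_inv_pos z hz := by simpa [Complex.div_ofReal_re] using div_pos hz hS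
  left_inv z _ := by
    have : (S : ℂ) ≠ 0 := Complex.ofReal_ne_zero.2 hS.ne'
    field_simp
    ring
  right_inv z _ := by
    have : (S : ℂ) ≠ 0 := Complex.ofReal_ne_zero.2 hS.ne'
    field_simp
    ring
  jacobian z _ := by
    simp only [Complex.add_re, Complex.re_ofReal_mul, Complex.I_mul_re, Complex.ofReal_im, neg_zero,
      add_zero, Complex.norm_real, Real.norm_eq_abs, sq_abs]
    rw [← hSC]
    ring

theorem re_ofReal_div_add {z : ℂ} {S α θ : ℝ} :
    ((S : ℂ) / (z - Complex.I * (α : ℂ)) + Complex.I * (θ : ℂ)).re =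
      S * z.re / ‖z - Complex.I * (α : ℂ)‖ ^ 2 := by
  simp [Complex.div_re, Complex.normSq_eq_norm_sq]

theorem sub_I_mul_ne_zero {z : ℂ} (hz : 0 < z.re) (α : ℝ) : z - Complex.I * (α : ℂ) ≠ 0 :=
  fun h => hz.ne' (by simpa using congrArg Complex.re h)

/-- Since `Re G = S Re z / |z - iα|^2` and `|G'| = S / |z - iα|^2`, the Jacobian side is `S^(ℓ+2)
(Re z)^ℓ / |z - iα|^(2(ℓ+2))`. Interchanging `α` and `θ` inverts the map. -/
theorem isWeightedAutomorphism_inversion (ℓ : ℕ) {β : ℂ} (hβ : β ≠ 0) {S : ℝ} (hS : 0 < S)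
    (hSβ : S ^ (ℓ + 2) = ‖β‖ ^ 2) (α θ : ℝ) :
    IsWeightedAutomorphism ℓ (fun z => β / (z - Complex.I * (α : ℂ)) ^ (ℓ + 2))
      (fun z => (S : ℂ) / (z - Complex.I * (α : ℂ)) + Complex.I * (θ : ℂ))
      (fun z => -(S : ℂ) / (z - Complex.I * (α : ℂ)) ^ 2)
      (fun z => (S : ℂ) / (z - Complex.I * (θ : ℂ)) + Complex.I * (α : ℂ)) where
  differentiableOn_weight := (differentiableOn_const _).div ((differentiableOn_id.sub_const _).pow _)
    fun z hz => pow_ne_zero _ (sub_I_mul_ne_zero hz α)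
  weight_ne_zero z hz := div_ne_zero hβ (pow_ne_zero _ (sub_I_mul_ne_zero hz α))
  hasDerivAt z hz := by
    have h1 : HasDerivAt (fun z : ℂ => z - Complex.I * (α : ℂ)) 1 z := (hasDerivAt_id z).sub_const _
    convert! ((hasDerivAt_const z (S : ℂ)).div h1 (sub_I_mul_ne_zero hz α)).add_const
      (Complex.I * (θ : ℂ)) using 1
    simp
  differentiableOn_inv := ((differentiableOn_const _).div (differentiableOn_id.sub_const _)
    fun z hz => sub_I_mul_ne_zero hz θ).add_const _
  re_pos z hz := by
    rw [re_ofReal_div_add]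
    have := norm_pos_iff.2 (sub_I_mul_ne_zero hz α)
    exact div_pos (mul_pos hS hz) (by positivity)
  re_inv_pos z hz := by
    rw [re_ofReal_div_add]
    have := norm_pos_iff.2 (sub_I_mul_ne_zero hz θ)
    exact div_pos (mul_pos hS hz) (by positivity)
  left_inv z hz := by
    have h1 : (S : ℂ) ≠ 0 := Complex.ofReal_ne_zero.2 hS.ne'
    rw [add_sub_cancel_right, div_div_cancel₀ h1, sub_add_cancel]
  right_inv z hz := by
    have h1 : (S : ℂ) ≠ 0 := Complex.ofReal_ne_zero.2 hS.ne'
    rw [add_sub_cancel_right, div_div_cancel₀ h1, sub_add_cancel]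
  jacobian z hz := by
    have h1 := norm_pos_iff.2 (sub_I_mul_ne_zero hz α)
    rw [re_ofReal_div_add, norm_div, norm_div, norm_pow, norm_pow, norm_neg, Complex.norm_real,
      Real.norm_eq_abs, div_pow |S|, sq_abs, div_pow ‖β‖, ← hSβ, div_pow, mul_pow]
    field_simp
    ring

theorem norm_sq_eq_pow_of_mul_conj_eq {c : ℂ} {S : ℝ} {n : ℕ}
    (h : c * starRingEnd ℂ c = (S : ℂ) ^ n) : ‖c‖ ^ 2 = S ^ n := by
  rw [Complex.mul_conj'] at h
  exact_mod_cast h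

/-- The symbols of a unitary weighted composition operator are of one of the two forms. -/
theorem IsUnitaryOperator.exists_symbols {ℓ : ℕ} {f : RightHalfPlane → ℂ}
    {g : RightHalfPlane → RightHalfPlane} (hg : Continuous fun z => (g z : ℂ))
    (hU : IsUnitaryOperator (maxWeightedComposition ℓ f g)) :
    (∃ (C : ℂ) (δ : ℝ), C ≠ 0 ∧
        (∀ z : RightHalfPlane,
          (g z : ℂ) = ((‖C‖ ^ (2 / ((ℓ : ℝ) + 2)) : ℝ) : ℂ) * (z : ℂ) + Complex.I * (δ : ℂ)) ∧
        (∀ z : RightHalfPlane, f z = C)) ∨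
      (∃ (β : ℂ) (α θ : ℝ), β ≠ 0 ∧
        (∀ z : RightHalfPlane,
          (g z : ℂ) = ((‖β‖ ^ (2 / ((ℓ : ℝ) + 2)) : ℝ) : ℂ) / ((z : ℂ) - Complex.I * (α : ℂ))
            + Complex.I * (θ : ℂ)) ∧
        (∀ z : RightHalfPlane, f z = β / ((z : ℂ) - Complex.I * (α : ℂ)) ^ (ℓ + 2))) := by
  set e := RightHalfPlane.one with he
  have he1 : (e : ℂ) = 1 := rfl
  have hpow := hU.add_conj_pow_eq
  have hfac := add_conj_div_factor (by omega) hg hpow e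
  set S : ℝ := (g e : ℂ).re with hSdef
  set t : ℝ := (g e : ℂ).im with htdef
  have hS : 0 < S := (g e).2
  have hS0 : (S : ℂ) ≠ 0 := Complex.ofReal_ne_zero.2 hS.ne'
  have hge : (g e : ℂ) = S + Complex.I * t := by
    rw [mul_comm]; exact (Complex.re_add_im _).symm
  have hge' : starRingEnd ℂ (g e : ℂ) = S - Complex.I * t := by
    rw [hge]; simp [sub_eq_add_neg]
  have hz1 : ∀ z : RightHalfPlane, (z : ℂ) + 1 ≠ 0 := fun z => by
    simpa [he1] using add_conj_ne_zero z.2 e.2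
  have hw1 : ∀ z : RightHalfPlane, starRingEnd ℂ (z : ℂ) + 1 ≠ 0 := fun z => by
    simpa using (map_ne_zero (starRingEnd ℂ)).2 (hz1 z)
  have hgz : ∀ z, (g z : ℂ) + (S - Complex.I * t) ≠ 0 := fun z => by
    rw [← hge']; exact add_conj_ne_zero (g z).2 (g e).2
  have hgw : ∀ z, starRingEnd ℂ (g z : ℂ) + (S + Complex.I * t) ≠ 0 := fun z => by
    rw [← hge, add_comm]; exact add_conj_ne_zero (g e).2 (g z).2
  -- `L` is `q(1,1) / q(z,1)`, with `q(1,1) = S`. Substituting `g z = S (z + 1) / L z - conj (g 1)`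
  -- turns the factorisation into the functional equation.
  obtain ⟨M, hM, hL⟩ := exists_affine_of_functional_equation
    (L := fun z => S * ((z : ℂ) + 1) / ((g z : ℂ) + (S - Complex.I * t))) (fun z w => by
      have h1 := hfac z w
      have h2 := add_conj_ne_zero z.2 w.2
      have h3 := hz1 z
      have h4 := hw1 w
      have h5 := hgz z
      have h6 := hgw w
      rw [hge', hge, he1, map_one] at h1
      rw [show (S : ℂ) + Complex.I * t + (S - Complex.I * t) = S * (1 + 1) by ring,
        add_comm (1 : ℂ) (starRingEnd ℂ (w : ℂ)),
        add_comm ((S : ℂ) + Complex.I * t) (starRingEnd ℂ (g w : ℂ)),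
        mul_div_cancel_right₀ _ (by norm_num)] at h1
      simp only [map_div₀, map_mul, map_add, map_sub, map_one, Complex.conj_ofReal, Complex.conj_I,
        neg_mul, sub_neg_eq_add]
      field_simp at h1 ⊢
      linear_combination h1)
  have hgL : ∀ z : RightHalfPlane, ((g z : ℂ) + (S - Complex.I * t)) * (1 + M * ((z : ℂ) - 1)) =
      S * ((z : ℂ) + 1) := fun z => by
    rw [← hL z, mul_div_cancel₀ _ (hgz z)]
  have hLne : ∀ z : RightHalfPlane, 1 + M * ((z : ℂ) - 1) ≠ 0 := fun z h0 => by
    have := hgL z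
    rw [h0, mul_zero] at this
    exact mul_ne_zero hS0 (hz1 z) this.symm
  have hfe : f e * starRingEnd ℂ (f e) = (S : ℂ) ^ (ℓ + 2) := by
    rw [← hpow e e, hge', hge, he1, map_one]
    congr 1
    ring
  have hfne : f e ≠ 0 := fun h0 => by
    rw [h0, zero_mul] at hfe
    exact pow_ne_zero _ hS0 hfe.symm
  have hfne' : starRingEnd ℂ (f e) ≠ 0 := (map_ne_zero _).2 hfne
  -- The power identity at `w = 1` reads `f z * conj (f 1) = (S / L z)^(ℓ+2)`, while `f 1 * conj (f
  -- 1) = S^(ℓ+2)`.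
  have hfz : ∀ z : RightHalfPlane, f z = f e / (1 + M * ((z : ℂ) - 1)) ^ (ℓ + 2) := fun z => by
    refine mul_right_cancel₀ hfne' ?_
    have h3 := hz1 z
    have h5 := hLne z
    rw [div_mul_eq_mul_div, hfe, ← hpow z e, hge', he1, map_one, ← div_pow]
    congr 1
    rw [div_eq_div_iff h3 h5, hgL z]
  have hnorm := norm_sq_eq_pow_of_mul_conj_eq hfe
  by_cases hM0 : M = 0
  · refine Or.inl ⟨f e, t, hfne, fun z => ?_, fun z => ?_⟩
    · rw [rpow_two_div_of_sq_eq_pow (norm_nonneg _) hS.le hnorm]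
      have := hgL z
      rw [hM0] at this
      linear_combination this
    · rw [hfz z, hM0]
      simp
  · have hM0' : starRingEnd ℂ M ≠ 0 := (map_ne_zero _).2 hM0
    set α : ℝ := -(M⁻¹).im with hα
    -- Divide `M + conj M = 2 |M|^2` by `|M|^2`.
    have hre : (M⁻¹).re = 1 := by
      have h1 : M⁻¹ + starRingEnd ℂ M⁻¹ = 2 := by
        rw [map_inv₀]
        field_simp
        linear_combination hM
      have := congrArg Complex.re h1
      simp only [Complex.add_re, Complex.conj_re, Complex.re_ofNat] at this
      linarith
    have hMinv : M⁻¹ = 1 - Complex.I * α := by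
      apply Complex.ext <;> simp [hα, hre]
    have hML : ∀ z : RightHalfPlane, 1 + M * ((z : ℂ) - 1) = M * ((z : ℂ) - Complex.I * α) :=
      fun z => by
        have : M * M⁻¹ = 1 := mul_inv_cancel₀ hM0
        rw [hMinv] at this
        linear_combination -this
    have hd : (1 - Complex.I * α : ℂ) ≠ 0 := hMinv ▸ inv_ne_zero hM0
    have hMeq : M = (1 - Complex.I * α)⁻¹ := by rw [← hMinv, inv_inv]
    have hnd : ‖(1 - Complex.I * α : ℂ)‖ ^ 2 = 1 + α ^ 2 := by
      rw [← Complex.normSq_eq_norm_sq, Complex.normSq_apply]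
      simp
      ring
    -- Here `L z = (z - iα) / (1 - iα)`, which gives `β`. Writing `z + 1 = (z - iα) + (1 + iα)` in
    -- `g z = S (z + 1) / L z - S + i t` gives numerator `S (1 + α^2)` and imaginary shift `t - α
    -- S`.
    refine Or.inr ⟨f e * (1 - Complex.I * α) ^ (ℓ + 2), α, t - α * S,
      mul_ne_zero hfne (pow_ne_zero _ hd), fun z => ?_, fun z => ?_⟩
    · rw [rpow_two_div_of_sq_eq_pow (S := S * (1 + α ^ 2)) (norm_nonneg _) (by positivity)
        (by rw [norm_mul, mul_pow, hnorm, norm_pow, ← pow_mul, mul_comm (ℓ + 2) 2, pow_mul, hnd,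
          mul_pow])]
      have h1 := hgL z
      have h2 := sub_I_mul_ne_zero z.2 α
      rw [hML, hMeq] at h1
      have h3 : ((g z : ℂ) + (S - Complex.I * t)) * ((z : ℂ) - Complex.I * α) =
          S * ((z : ℂ) + 1) * (1 - Complex.I * α) := by
        rw [← h1]
        field_simp
      push_cast
      refine mul_right_cancel₀ h2 ?_
      rw [add_mul, div_mul_cancel₀ _ h2]
      linear_combination h3 - S * α ^ 2 * Complex.I_sq
    · have h2 := sub_I_mul_ne_zero z.2 α
      rw [hfz, hML, hMeq, mul_pow, inv_pow]
      field_simp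

theorem mainTheorem3 (ℓ : ℕ) (f : RightHalfPlane → ℂ) (g : RightHalfPlane → RightHalfPlane)
    (hf : IsAnalyticRHP f) (hg : IsAnalyticRHP (fun z => (g z : ℂ))) :
    IsUnitaryOperator (maxWeightedComposition ℓ f g) ↔
      (∃ (C : ℂ) (δ : ℝ), C ≠ 0 ∧
        (∀ z : RightHalfPlane,
          (g z : ℂ) = ((‖C‖ ^ (2 / ((ℓ : ℝ) + 2)) : ℝ) : ℂ) * (z : ℂ) + Complex.I * (δ : ℂ)) ∧
        (∀ z : RightHalfPlane, f z = C)) ∨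
      (∃ (β : ℂ) (α θ : ℝ), β ≠ 0 ∧
        (∀ z : RightHalfPlane,
          (g z : ℂ) = ((‖β‖ ^ (2 / ((ℓ : ℝ) + 2)) : ℝ) : ℂ) / ((z : ℂ) - Complex.I * (α : ℂ))
            + Complex.I * (θ : ℂ)) ∧
        (∀ z : RightHalfPlane, f z = β / ((z : ℂ) - Complex.I * (α : ℂ)) ^ (ℓ + 2))) := by

  constructor
  · exact fun hU => hU.exists_symbols hg.continuous
  · rintro (⟨C, δ, hC, hgC, hfC⟩ | ⟨β, α, θ, hβ, hgβ, hfβ⟩)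
    · exact (isWeightedAutomorphism_affine ℓ hC
        (Real.rpow_pos_of_pos (norm_pos_iff.2 hC) _) (rpow_two_div_pow (norm_nonneg C) ℓ)
        δ).isUnitaryOperator hfC hgC
    · exact (isWeightedAutomorphism_inversion ℓ hβ
        (Real.rpow_pos_of_pos (norm_pos_iff.2 hβ) _) (rpow_two_div_pow (norm_nonneg β) ℓ)
        α θ).isUnitaryOperator hfβ hgβ
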